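/- All Boolean algebras have $0$ and $1$ (possibly $0=1$); $a^*$ denotes the complement of $a$. A *contact relation* on a Boolean algebra $B$ is a binary relation $\rho$ such that: $a\ne 0$ implies $a\rho a$; $a\rho b$ implies $a\ne 0$ and $b\neq 0$; $a\rho b$ implies $b\rho a$; and $a\rho(b\vee c)$ iff $a\rho b$ or $a\rho c$. Write $a\ll_\rho b$ if $a\rho b^*$ fails. A *complete local contact algebra* (CLCA) is a triple $(B,\rho,\mathbb B)$, where $B$ is a complete Boolean algebra, $\rho$ is a contact relation on $B$ and $\mathbb B$ is a (possibly non-proper) ideal of $B$, such that: (BC1) if $a\in\mathbb B$, $c\in B$ and $a\ll_\rho c$, then $a\ll_\rho b\ll_\rho c$ for some $b\in\mathbb B$; (BC2) if $a\rho b$, then $a\rho(c\wedge b)$ for some $c\in\mathbb B$; (BC3) if $a\ne0$, then $b\ll_\rho a$ for some $b\in\mathbb B\setminus\{0\}$. A *$\delta$-ideal* of $(B,\rho,\mathbb B)$ is an ideal $I$ of $B$ with $I\subseteq\mathbb B$ such that for every $a\in I$ there is $b\in I$ with $a\ll_\rho b$. The $\delta$-ideals, ordered by inclusion, form a complete lattice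 $I(B,\rho,\mathbb B)$ (in fact a frame), in which $\wedge$ and $\bigvee$ below are taken. Let $\mathbf{MDHLC}$ be the category whose objects are all CLCAs, and whose morphisms $\varphi:(A,\rho,\mathbb B)\to(B,\eta,\mathbb B')$ are the multi-valued maps assigning to each $a\in A$ a subset $\varphi(a)\subseteq B$ such that: (M1) $\varphi(a)\in I(B,\eta,\mathbb B')$ for every $a\in A$; (M2) $\varphi(a\wedge b)=\varphi(a)\wedge\varphi(b)$ for all $a,b\in A$; (M3) $\varphi(a)=\bigvee\{\varphi(b) : b\in\mathbb B,\ b\ll_\rho a\}$ for every $a\in A$; (M4) $\varphi(0)=\{0\}$; (M5) if $a_i,b_i\in\mathbb B$ and $a_i\ll_\rho b_i$ for $i=1,2$, then $\varphi(a_1\vee a_2)\subseteq\varphi(b_1)\vee\varphi(b_2)$; (M6) for every $b\in\mathbb B'$ there is $a\in\mathbb B$ with $b\in\varphi(a)$. The composition of $\varphi:(A_1,\rho_1,\mathbb B_1)\to(A_2,\rho_2,\mathbb B_2)$ and $\psi:(A_2,\rho_2,\mathbb B_2)\to(A_3,\rho_3,\mathbb B_3)$ is $(\psi\diamond\varphi)(a)=\bigvee\{\psi(b)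 : b\in\varphi(a)\}$, and the identity of $(A,\rho,\mathbb B)$ is $a\mapsto\{b\in\mathbb B : b\ll_\rho a\}$. Let $\mathbf{HLC}$ be the category of all locally compact Hausdorff spaces and all continuous maps. **Theorem.** The categories $\mathbf{HLC}$ and $\mathbf{MDHLC}$ are dually equivalent, that is, $\mathbf{HLC}^{\mathrm{op}}$ and $\mathbf{MDHLC}$ are equivalent categories. -/

import Mathlib

open CategoryTheory

universe u

/-- `C` is a contact relation on the Boolean algebra `B`. -/
structure IsContact {B : Type u} [BooleanAlgebra B] (C : B → B → Prop) : Prop where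
  /-- (C1) -/
  refl : ∀ a, a ≠ ⊥ → C a a
  /-- (C2) -/
  ne_bot : ∀ a b, C a b → a ≠ ⊥ ∧ b ≠ ⊥
  /-- (C3) -/
  symm : ∀ a b, C a b → C b a
  /-- (C4) -/
  sup_iff : ∀ a b c, C a (b ⊔ c) ↔ C a b ∨ C a c

/-- Non-tangential inclusion `a ≪ b`: `a` is not in contact with the complement of `b`. -/
def NonTangential {B : Type u} [BooleanAlgebra B] (C : B → B → Prop) (a b : B) : Prop :=
  ¬ C a bᶜ

/-- A local contact algebra structure on a Boolean algebra `B`: a contact relation together with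
a (possibly non-proper) ideal of bounded elements satisfying (BC1)-(BC3). -/
structure LocalContact (B : Type u) [BooleanAlgebra B] where
  /-- the contact relation -/
  rel : B → B → Prop
  isContact : IsContact rel
  /-- the ideal of bounded elements -/
  bounded : Order.Ideal B
  /-- (BC1) -/
  interpolate : ∀ a ∈ bounded, ∀ c, NonTangential rel a c →
    ∃ b ∈ bounded, NonTangential rel a b ∧ NonTangential rel b c
  /-- (BC2) -/
  local_rel : ∀ a b, rel a b → ∃ c ∈ bounded, rel a (c ⊓ b)
  /-- (BC3) -/
  exists_bounded : ∀ a, a ≠ ⊥ → ∃ b ∈ bounded, b ≠ ⊥ ∧ NonTangential rel b a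

namespace LocalContact

variable {B : Type u} [BooleanAlgebra B] (L : LocalContact B)

/-- The non-tangential inclusion of a local contact algebra. -/
def ll (a b : B) : Prop := NonTangential L.rel a b

variable {L}

theorem rel_mono_right {a b c : B} (h : L.rel a b) (hbc : b ≤ c) : L.rel a c := by
  have := (L.isContact.sup_iff a b c).2 (Or.inl h)
  rwa [sup_eq_right.2 hbc] at this

theorem rel_mono {a b c d : B} (h : L.rel a b) (hac : a ≤ c) (hbd : b ≤ d) : L.rel c d :=
  rel_mono_right (L.isContact.symm _ _ (rel_mono_right (L.isContact.symm _ _ h) hac)) hbd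

theorem ll_mono {a b c d : B} (h : L.ll b c) (hab : a ≤ b) (hcd : c ≤ d) : L.ll a d :=
  fun h' => h (rel_mono h' hab (compl_le_compl hcd))

theorem ll_le {a b : B} (h : L.ll a b) : a ≤ b := by
  by_contra hn
  have h0 : a ⊓ bᶜ ≠ ⊥ := fun h0 => hn (disjoint_compl_right_iff.1 (disjoint_iff.2 h0))
  exact h (rel_mono (L.isContact.refl _ h0) inf_le_left inf_le_right)

theorem bot_ll (a : B) : L.ll ⊥ a := fun h => (L.isContact.ne_bot _ _ h).1 rfl

theorem ll_top (a : B) : L.ll a ⊤ := fun h => (L.isContact.ne_bot _ _ h).2 compl_top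

theorem ll_sup_left {a b c : B} (ha : L.ll a c) (hb : L.ll b c) : L.ll (a ⊔ b) c := by
  intro h
  rcases (L.isContact.sup_iff _ _ _).1 (L.isContact.symm _ _ h) with h | h
  · exact ha (L.isContact.symm _ _ h)
  · exact hb (L.isContact.symm _ _ h)

theorem ll_sup {a b c d : B} (h : L.ll a b) (h' : L.ll c d) : L.ll (a ⊔ c) (b ⊔ d) :=
  ll_sup_left (ll_mono h le_rfl le_sup_left) (ll_mono h' le_rfl le_sup_right)

theorem ll_inf {a b c : B} (h : L.ll a b) (h' : L.ll a c) : L.ll a (b ⊓ c) := by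
  intro hn
  unfold ll NonTangential at h h'
  rw [compl_inf] at hn
  exact ((L.isContact.sup_iff _ _ _).1 hn).elim h h'

end LocalContact

/-- A `δ`-ideal: an ideal `I` of bounded elements such that every `a ∈ I` satisfies `a ≪ b` for
some `b ∈ I`. -/
structure DeltaIdeal {B : Type u} [BooleanAlgebra B] (L : LocalContact B) extends
    Order.Ideal B where
  bounded' : ∀ a ∈ toIdeal, a ∈ L.bounded
  rounded' : ∀ a ∈ toIdeal, ∃ b ∈ toIdeal, L.ll a b

namespace DeltaIdeal

variable {B : Type u} [BooleanAlgebra B] {L : LocalContact B}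

theorem toIdeal_injective :
    Function.Injective (toIdeal : DeltaIdeal L → Order.Ideal B) := by
  rintro ⟨I, _, _⟩ ⟨J, _, _⟩ h
  cases h
  rfl

instance : SetLike (DeltaIdeal L) B where
  coe I := (I.toIdeal : Set B)
  coe_injective _ _ h := toIdeal_injective (SetLike.coe_injective h)

/-- `δ`-ideals are ordered by inclusion. -/
instance : PartialOrder (DeltaIdeal L) := .ofSetLike (DeltaIdeal L) B

@[simp] theorem mem_toIdeal {I : DeltaIdeal L} {a : B} : a ∈ I.toIdeal ↔ a ∈ I := Iff.rfl

@[ext] theorem ext {I J : DeltaIdeal L} (h : ∀ a, a ∈ I ↔ a ∈ J) : I = J := SetLike.ext h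

theorem le_def {I J : DeltaIdeal L} : I ≤ J ↔ ∀ a ∈ I, a ∈ J := Iff.rfl

theorem mem_bounded {I : DeltaIdeal L} {a : B} (h : a ∈ I) : a ∈ L.bounded := I.bounded' a h

theorem exists_ll {I : DeltaIdeal L} {a : B} (h : a ∈ I) : ∃ b ∈ I, L.ll a b := I.rounded' a h

theorem mem_of_le {I : DeltaIdeal L} {a b : B} (h : b ∈ I) (hab : a ≤ b) : a ∈ I :=
  I.toIdeal.lower hab h

theorem bot_mem (I : DeltaIdeal L) : ⊥ ∈ I := I.toIdeal.bot_mem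

theorem sup_mem {I : DeltaIdeal L} {a b : B} (ha : a ∈ I) (hb : b ∈ I) : a ⊔ b ∈ I :=
  Order.Ideal.sup_mem (s := I.toIdeal) ha hb

/-- Build a `δ`-ideal from a set. -/
def ofSet (s : Set B) (h0 : ⊥ ∈ s) (hl : ∀ a b, a ≤ b → b ∈ s → a ∈ s)
    (hs : ∀ a ∈ s, ∀ b ∈ s, a ⊔ b ∈ s) (hb : ∀ a ∈ s, a ∈ L.bounded)
    (hr : ∀ a ∈ s, ∃ b ∈ s, L.ll a b) : DeltaIdeal L where
  carrier := s
  lower' := fun b a hab h => hl a b hab h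
  nonempty' := ⟨⊥, h0⟩
  directed' := fun a ha b hb => ⟨a ⊔ b, hs a ha b hb, le_sup_left, le_sup_right⟩
  bounded' := hb
  rounded' := hr

/-- The intersection of two `δ`-ideals. -/
def inter (I J : DeltaIdeal L) : DeltaIdeal L :=
  ofSet {a | a ∈ I ∧ a ∈ J} ⟨I.bot_mem, J.bot_mem⟩
    (fun _ _ hab h => ⟨mem_of_le h.1 hab, mem_of_le h.2 hab⟩)
    (fun _ ha _ hb => ⟨sup_mem ha.1 hb.1, sup_mem ha.2 hb.2⟩)
    (fun _ h => mem_bounded h.1)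
    (fun a h => by
      obtain ⟨b, hb, hab⟩ := exists_ll h.1
      obtain ⟨c, hc, hac⟩ := exists_ll h.2
      exact ⟨b ⊓ c, ⟨mem_of_le hb inf_le_left, mem_of_le hc inf_le_right⟩,
        LocalContact.ll_inf hab hac⟩)

/-- The join of a family of `δ`-ideals: the finite joins of their elements. -/
def join (S : Set (DeltaIdeal L)) : DeltaIdeal L :=
  ofSet {a | ∃ t : Finset B, (∀ x ∈ t, ∃ I ∈ S, x ∈ I) ∧ a = t.sup id}
    ⟨∅, by simp, by simp⟩
    (by
      classical
      rintro a _ hab ⟨t, ht, rfl⟩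
      refine ⟨t.image (a ⊓ ·), ?_, ?_⟩
      · intro x hx
        obtain ⟨y, hy, rfl⟩ := Finset.mem_image.1 hx
        obtain ⟨I, hI, hyI⟩ := ht y hy
        exact ⟨I, hI, mem_of_le hyI inf_le_right⟩
      · rw [Finset.sup_image, Function.id_comp]
        conv_lhs => rw [← inf_eq_left.2 hab, Finset.sup_inf_distrib_left]
        rfl)
    (by
      classical
      rintro _ ⟨t, ht, rfl⟩ _ ⟨t', ht', rfl⟩
      refine ⟨t ∪ t', ?_, (Finset.sup_union).symm⟩
      intro x hx
      exact (Finset.mem_union.1 hx).elim (ht x) (ht' x))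
    (by
      rintro _ ⟨t, ht, rfl⟩
      refine Finset.sup_induction (p := (· ∈ L.bounded)) (Order.Ideal.bot_mem _)
        (fun a ha b hb => Order.Ideal.sup_mem ha hb) ?_
      intro x hx
      obtain ⟨I, _, hxI⟩ := ht x hx
      exact mem_bounded hxI)
    (by
      classical
      rintro _ ⟨t, ht, rfl⟩
      have key : ∀ x : B, ∃ y : B, x ∈ t → (∃ I ∈ S, y ∈ I) ∧ L.ll x y := by
        intro x
        by_cases hx : x ∈ t
        · obtain ⟨I, hI, hxI⟩ := ht x hx
          obtain ⟨y, hy, hxy⟩ := exists_ll hxI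
          exact ⟨y, fun _ => ⟨⟨I, hI, hy⟩, hxy⟩⟩
        · exact ⟨x, fun h => absurd h hx⟩
      choose g hg using key
      refine ⟨(t.image g).sup id, ⟨t.image g, ?_, rfl⟩, ?_⟩
      · intro y hy
        obtain ⟨x, hx, rfl⟩ := Finset.mem_image.1 hy
        exact (hg x hx).1
      · refine Finset.sup_induction (p := fun a => L.ll a ((t.image g).sup id))
          (LocalContact.bot_ll _) (fun a ha b hb => LocalContact.ll_sup_left ha hb) ?_
        intro x hx
        exact LocalContact.ll_mono (hg x hx).2 le_rfl
          (Finset.le_sup (f := id) (Finset.mem_image_of_mem g hx)))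

theorem isLUB_join (S : Set (DeltaIdeal L)) : IsLUB S (join S) := by
  constructor
  · intro I hI a ha
    refine ⟨{a}, ?_, by simp⟩
    intro x hx
    rw [Finset.mem_singleton.1 hx]
    exact ⟨I, hI, ha⟩
  · intro J hJ a ha
    obtain ⟨t, ht, rfl⟩ := ha
    refine Finset.sup_induction (p := (· ∈ J)) J.bot_mem (fun a ha b hb => sup_mem ha hb) ?_
    intro x hx
    obtain ⟨I, hI, hxI⟩ := ht x hx
    exact hJ hI hxI

/-- The complete lattice of `δ`-ideals, ordered by inclusion: binary meets are intersections, and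
joins consist of the finite joins of elements. -/
instance : CompleteLattice (DeltaIdeal L) :=
  letI : SupSet (DeltaIdeal L) := ⟨join⟩
  { completeLatticeOfSup (DeltaIdeal L) isLUB_join with
    inf := inter
    inf_le_left := fun _ _ _ h => h.1
    inf_le_right := fun _ _ _ h => h.2
    le_inf := fun _ _ _ h h' _ ha => ⟨h ha, h' ha⟩ }

theorem mem_inf {I J : DeltaIdeal L} {a : B} : a ∈ I ⊓ J ↔ a ∈ I ∧ a ∈ J := Iff.rfl

theorem mem_sup {I J : DeltaIdeal L} {a b : B} (ha : a ∈ I) (hb : b ∈ J) : a ⊔ b ∈ I ⊔ J :=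
  sup_mem ((le_sup_left : I ≤ I ⊔ J) ha) ((le_sup_right : J ≤ I ⊔ J) hb)

theorem exists_of_mem_sup {I J : DeltaIdeal L} {c : B} (h : c ∈ I ⊔ J) :
    ∃ a ∈ I, ∃ b ∈ J, c = a ⊔ b := by
  have hle : I ⊔ J ≤ ofSet (L := L) {c | ∃ a ∈ I, ∃ b ∈ J, c = a ⊔ b}
      ⟨⊥, I.bot_mem, ⊥, J.bot_mem, by simp⟩
      (by
        rintro c _ hc ⟨a, ha, b, hb, rfl⟩
        refine ⟨c ⊓ a, mem_of_le ha inf_le_right, c ⊓ b, mem_of_le hb inf_le_right, ?_⟩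
        rw [← inf_sup_left, inf_eq_left.2 hc])
      (by
        rintro _ ⟨a, ha, b, hb, rfl⟩ _ ⟨a', ha', b', hb', rfl⟩
        exact ⟨a ⊔ a', sup_mem ha ha', b ⊔ b', sup_mem hb hb', sup_sup_sup_comm _ _ _ _⟩)
      (by
        rintro _ ⟨a, ha, b, hb, rfl⟩
        exact Order.Ideal.sup_mem (mem_bounded ha) (mem_bounded hb))
      (by
        rintro _ ⟨a, ha, b, hb, rfl⟩
        obtain ⟨a', ha', h⟩ := exists_ll ha
        obtain ⟨b', hb', h'⟩ := exists_ll hb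
        exact ⟨a' ⊔ b', ⟨a', ha', b', hb', rfl⟩, LocalContact.ll_sup h h'⟩) :=
    sup_le (fun a ha => ⟨a, ha, ⊥, J.bot_mem, by simp⟩)
      (fun b hb => ⟨⊥, I.bot_mem, b, hb, by simp⟩)
  exact hle h

/-- A join of a monotone map over an ideal-like set is a union. -/
theorem mem_biSup {A : Type u} [BooleanAlgebra A] (s : Set A) (h0 : ⊥ ∈ s)
    (hs : ∀ a ∈ s, ∀ b ∈ s, a ⊔ b ∈ s) (f : A → DeltaIdeal L) (hf : Monotone f) {x : B} :
    x ∈ (⨆ a ∈ s, f a) ↔ ∃ a ∈ s, x ∈ f a := by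
  constructor
  · intro hx
    have hle : (⨆ a ∈ s, f a) ≤ ofSet (L := L) {x | ∃ a ∈ s, x ∈ f a}
        ⟨⊥, h0, bot_mem _⟩
        (fun x y hxy ⟨a, ha, h⟩ => ⟨a, ha, mem_of_le h hxy⟩)
        (fun x ⟨a, ha, h⟩ y ⟨b, hb, h'⟩ => ⟨a ⊔ b, hs a ha b hb,
          sup_mem (hf le_sup_left h) (hf le_sup_right h')⟩)
        (fun x ⟨a, ha, h⟩ => mem_bounded h)
        (fun x ⟨a, ha, h⟩ => by
          obtain ⟨y, hy, hxy⟩ := exists_ll h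
          exact ⟨y, ⟨a, ha, hy⟩, hxy⟩) :=
      iSup₂_le fun a ha x hx => ⟨a, ha, hx⟩
    exact hle hx
  · rintro ⟨a, ha, hx⟩
    exact (le_iSup₂ (f := fun a (_ : a ∈ s) => f a) a ha) hx

/-- The principal `δ`-ideal `I_a`, consisting of the bounded `b` with `b ≪ a`. -/
def principal (L : LocalContact B) (a : B) : DeltaIdeal L :=
  ofSet {b | b ∈ L.bounded ∧ L.ll b a} ⟨Order.Ideal.bot_mem _, LocalContact.bot_ll _⟩
    (fun _ _ hxy h => ⟨L.bounded.lower hxy h.1, LocalContact.ll_mono h.2 hxy le_rfl⟩)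
    (fun _ hx _ hy => ⟨Order.Ideal.sup_mem hx.1 hy.1, LocalContact.ll_sup_left hx.2 hy.2⟩)
    (fun _ h => h.1)
    (fun x h => by
      obtain ⟨b, hb, h1, h2⟩ := L.interpolate x h.1 a h.2
      exact ⟨b, ⟨hb, h2⟩, h1⟩)

theorem mem_principal {a b : B} : b ∈ principal L a ↔ b ∈ L.bounded ∧ L.ll b a := Iff.rfl

theorem principal_mono : Monotone (principal L) :=
  fun _ _ h _ hx => ⟨hx.1, LocalContact.ll_mono hx.2 le_rfl h⟩

end DeltaIdeal

/-- The objects of the category: complete local contact algebras. -/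
structure MDHLC : Type (u + 1) where
  /-- the underlying set -/
  carrier : Type u
  [str : CompleteBooleanAlgebra carrier]
  /-- the contact relation and the ideal of bounded elements -/
  loc : LocalContact carrier

namespace MDHLC

attribute [instance] MDHLC.str

/-- A morphism: a multi-valued map `a ↦ φ(a)` satisfying (M1)-(M6). -/
structure Hom (A B : MDHLC.{u}) where
  /-- the values are `δ`-ideals: this is (M1) -/
  toFun : A.carrier → DeltaIdeal B.loc
  /-- (M2) -/
  map_inf : ∀ a b, toFun (a ⊓ b) = toFun a ⊓ toFun b
  /-- (M3) -/
  map_eq_iSup : ∀ a, toFun a = ⨆ b ∈ {b | b ∈ A.loc.bounded ∧ A.loc.ll b a}, toFun b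
  /-- (M4) -/
  map_bot : (toFun ⊥ : Set B.carrier) = {⊥}
  /-- (M5) -/
  map_sup_le : ∀ a₁ ∈ A.loc.bounded, ∀ a₂ ∈ A.loc.bounded,
    ∀ b₁ ∈ A.loc.bounded, ∀ b₂ ∈ A.loc.bounded, A.loc.ll a₁ b₁ → A.loc.ll a₂ b₂ →
      toFun (a₁ ⊔ a₂) ≤ toFun b₁ ⊔ toFun b₂
  /-- (M6) -/
  exists_mem : ∀ b ∈ B.loc.bounded, ∃ a ∈ A.loc.bounded, b ∈ toFun a

namespace Hom

@[ext] theorem ext {A B : MDHLC.{u}} {φ ψ : Hom A B} (h : ∀ a, φ.toFun a = ψ.toFun a) :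
    φ = ψ := by
  cases φ
  cases ψ
  congr
  exact funext h

theorem mono {A B : MDHLC.{u}} (φ : Hom A B) : Monotone φ.toFun := by
  intro a b h
  rw [← inf_eq_left, ← φ.map_inf, inf_eq_left.2 h]

theorem mem_iff {A B : MDHLC.{u}} (φ : Hom A B) {a : A.carrier} {x : B.carrier} :
    x ∈ φ.toFun a ↔ ∃ b, (b ∈ A.loc.bounded ∧ A.loc.ll b a) ∧ x ∈ φ.toFun b := by
  rw [φ.map_eq_iSup a]
  exact DeltaIdeal.mem_biSup _ (DeltaIdeal.bot_mem (DeltaIdeal.principal A.loc a))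
    (fun _ ha _ hb => DeltaIdeal.sup_mem (I := DeltaIdeal.principal A.loc a) ha hb) _ φ.mono

theorem mem_biSup {A B C : MDHLC.{u}} (φ : Hom A B) (ψ : Hom B C) {a : A.carrier}
    {x : C.carrier} :
    x ∈ (⨆ b ∈ φ.toFun a, ψ.toFun b) ↔ ∃ b ∈ φ.toFun a, x ∈ ψ.toFun b :=
  DeltaIdeal.mem_biSup (φ.toFun a : Set B.carrier) (DeltaIdeal.bot_mem _)
    (fun _ ha _ hb => DeltaIdeal.sup_mem ha hb) _ ψ.mono

/-- The identity morphism `a ↦ I_a`. -/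
def id (A : MDHLC.{u}) : Hom A A where
  toFun := DeltaIdeal.principal A.loc
  map_inf a b := by
    ext x
    constructor
    · rintro ⟨hx, h⟩
      exact ⟨⟨hx, LocalContact.ll_mono h le_rfl inf_le_left⟩,
        ⟨hx, LocalContact.ll_mono h le_rfl inf_le_right⟩⟩
    · rintro ⟨h, h'⟩
      exact ⟨h.1, LocalContact.ll_inf h.2 h'.2⟩
  map_eq_iSup a := by
    apply le_antisymm
    · rintro x ⟨hx, h⟩
      obtain ⟨b, hb, h1, h2⟩ := A.loc.interpolate x hx a h
      exact (le_iSup₂ (f := fun b (_ : b ∈ {b | b ∈ A.loc.bounded ∧ A.loc.ll b a}) =>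
        DeltaIdeal.principal A.loc b) b ⟨hb, h2⟩) ⟨hx, h1⟩
    · exact iSup₂_le fun b hb => DeltaIdeal.principal_mono (LocalContact.ll_le hb.2)
  map_bot := by
    ext x
    constructor
    · rintro ⟨_, h⟩
      exact le_bot_iff.1 (LocalContact.ll_le h)
    · rintro rfl
      exact DeltaIdeal.bot_mem _
  map_sup_le a₁ h₁ a₂ h₂ b₁ _ b₂ _ hab₁ hab₂ := by
    rintro c ⟨hc, hca⟩
    have hc' : c = (c ⊓ a₁) ⊔ (c ⊓ a₂) := by
      rw [← inf_sup_left, inf_eq_left.2 (LocalContact.ll_le hca)]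
    change c ∈ DeltaIdeal.principal A.loc b₁ ⊔ DeltaIdeal.principal A.loc b₂
    rw [hc']
    exact DeltaIdeal.mem_sup
      ⟨A.loc.bounded.lower inf_le_left hc, LocalContact.ll_mono hab₁ inf_le_right le_rfl⟩
      ⟨A.loc.bounded.lower inf_le_left hc, LocalContact.ll_mono hab₂ inf_le_right le_rfl⟩
  exists_mem b hb := by
    obtain ⟨a, ha, h, _⟩ := A.loc.interpolate b hb ⊤ (LocalContact.ll_top b)
    exact ⟨a, ha, hb, h⟩

/-- The composition `(ψ ⋄ φ)(a) = ⋁ {ψ(b) | b ∈ φ(a)}`. -/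
def comp {A B C : MDHLC.{u}} (φ : Hom A B) (ψ : Hom B C) : Hom A C where
  toFun a := ⨆ b ∈ φ.toFun a, ψ.toFun b
  map_inf a b := by
    ext x
    rw [DeltaIdeal.mem_inf, mem_biSup, mem_biSup, mem_biSup]
    constructor
    · rintro ⟨c, hc, hx⟩
      rw [φ.map_inf] at hc
      exact ⟨⟨c, hc.1, hx⟩, ⟨c, hc.2, hx⟩⟩
    · rintro ⟨⟨c, hc, hx⟩, ⟨d, hd, hx'⟩⟩
      refine ⟨c ⊓ d, ?_, ?_⟩
      · rw [φ.map_inf]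
        exact ⟨DeltaIdeal.mem_of_le hc inf_le_left, DeltaIdeal.mem_of_le hd inf_le_right⟩
      · rw [ψ.map_inf]
        exact ⟨hx, hx'⟩
  map_eq_iSup a := by
    apply le_antisymm
    · intro x hx
      obtain ⟨c, hc, hxc⟩ := (mem_biSup φ ψ).1 hx
      obtain ⟨b, hb, hcb⟩ := φ.mem_iff.1 hc
      exact (le_iSup₂ (f := fun b (_ : b ∈ {b | b ∈ A.loc.bounded ∧ A.loc.ll b a}) =>
        ⨆ c ∈ φ.toFun b, ψ.toFun c) b hb) ((mem_biSup φ ψ).2 ⟨c, hcb, hxc⟩)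
    · refine iSup₂_le fun b hb x hx => ?_
      obtain ⟨c, hc, hxc⟩ := (mem_biSup φ ψ).1 hx
      exact (mem_biSup φ ψ).2 ⟨c, φ.mono (LocalContact.ll_le hb.2) hc, hxc⟩
  map_bot := by
    ext x
    rw [SetLike.mem_coe, mem_biSup, ← ψ.map_bot]
    constructor
    · rintro ⟨b, hb, hx⟩
      rw [← SetLike.mem_coe, φ.map_bot] at hb
      rwa [Set.mem_singleton_iff.1 hb] at hx
    · intro hx
      exact ⟨⊥, DeltaIdeal.bot_mem _, hx⟩
  map_sup_le a₁ h₁ a₂ h₂ b₁ k₁ b₂ k₂ hab₁ hab₂ := by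
    intro x hx
    obtain ⟨c, hc, hxc⟩ := (mem_biSup φ ψ).1 hx
    obtain ⟨d, hd, e, he, rfl⟩ := DeltaIdeal.exists_of_mem_sup
      (φ.map_sup_le a₁ h₁ a₂ h₂ b₁ k₁ b₂ k₂ hab₁ hab₂ hc)
    obtain ⟨d', hd', hdd⟩ := DeltaIdeal.exists_ll hd
    obtain ⟨e', he', hee⟩ := DeltaIdeal.exists_ll he
    have hx' := ψ.map_sup_le d (DeltaIdeal.mem_bounded hd) e (DeltaIdeal.mem_bounded he)
      d' (DeltaIdeal.mem_bounded hd') e' (DeltaIdeal.mem_bounded he') hdd hee hxc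
    exact (sup_le_sup
      (le_iSup₂ (f := fun b (_ : b ∈ φ.toFun b₁) => ψ.toFun b) d' hd')
      (le_iSup₂ (f := fun b (_ : b ∈ φ.toFun b₂) => ψ.toFun b) e' he')) hx'
  exists_mem c hc := by
    obtain ⟨b, hb, hcb⟩ := ψ.exists_mem c hc
    obtain ⟨a, ha, hba⟩ := φ.exists_mem b hb
    exact ⟨a, ha, (mem_biSup φ ψ).2 ⟨b, hba, hcb⟩⟩

theorem mem_comp {A B C : MDHLC.{u}} {φ : Hom A B} {ψ : Hom B C} {a : A.carrier}
    {x : C.carrier} : x ∈ (comp φ ψ).toFun a ↔ ∃ b ∈ φ.toFun a, x ∈ ψ.toFun b :=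
  mem_biSup φ ψ

end Hom

instance : Category MDHLC.{u} where
  Hom := Hom
  id := Hom.id
  comp φ ψ := Hom.comp φ ψ
  id_comp {A B} φ := by
    ext a x
    rw [Hom.mem_comp, φ.mem_iff]
    rfl
  comp_id {A B} φ := by
    ext a x
    rw [Hom.mem_comp]
    constructor
    · rintro ⟨b, hb, hx⟩
      exact DeltaIdeal.mem_of_le hb (LocalContact.ll_le hx.2)
    · intro hx
      obtain ⟨b, hb, hxb⟩ := DeltaIdeal.exists_ll hx
      exact ⟨b, hb, DeltaIdeal.mem_bounded hx, hxb⟩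
  assoc {A B C D} φ ψ χ := by
    ext a x
    simp only [Hom.mem_comp]
    constructor
    · rintro ⟨c, ⟨b, hb, hc⟩, hx⟩
      exact ⟨b, hb, c, hc, hx⟩
    · rintro ⟨b, hb, c, hc, hx⟩
      exact ⟨c, ⟨b, hb, hc⟩, hx⟩

end MDHLC

/-- The category of locally compact Hausdorff spaces and continuous maps. -/
abbrev HLC : Type (u + 1) :=
  ObjectProperty.FullSubcategory fun X : TopCat.{u} => T2Space X ∧ LocallyCompactSpace X

/-! The equivalence sends a space `X` to its algebra of regular open sets, with contact meaning that
closures meet and bounded meaning relatively compact. A continuous map `f` goes to the morphism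
whose value at `V` consists of the `U` with compact closure inside `f ⁻¹' V`.

The translation between the two sides is a bijection between `δ`-ideals of this algebra and open
sets of `X` (`union_idealOf`, `idealOf_union`): an ideal goes to its union, and compactness recovers
the ideal. A morphism is thus an assignment of open sets of `X` to regular open sets of `Y`.

Faithfulness holds because regular open sets separate points. For fullness, fix `x` and consider the
`V` whose assigned open set contains `x`. By (M6), (M2) and (M4) their closures have a common point
`y`. By (M3) and (M5) the assigned open set of `V` contains `x` exactly when `y ∈ V`
(`mem_union_iff_of_forall_mem_closure`), so `x ↦ y` induces the morphism.

For essential surjectivity, the points are the rounded decisive filters. The prime ideal theorem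
supplies enough of them to detect contact (`exists_of_rel`), ultrafilters give compactness
(`isCompact_closure_basic`), and completeness makes every regular open set basic
(`exists_basic_eq`). -/

open Set TopologicalSpace

/-! ### Regular open sets of a topological space -/

/-- The regular elements of a frame form a complete Boolean algebra. -/
instance Heyting.Regular.instCompleteBooleanAlgebra {α : Type u} [Order.Frame α] :
    CompleteBooleanAlgebra (Heyting.Regular α) :=
  let L : CompleteLattice (Heyting.Regular α) := Heyting.Regular.gi.liftCompleteLattice
  { (inferInstance : BooleanAlgebra (Heyting.Regular α)) with
    sSup := L.sSup
    sInf := L.sInf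
    isLUB_sSup := L.isLUB_sSup
    isGLB_sInf := L.isGLB_sInf }

/-- The complete Boolean algebra of regular open subsets of a topological space. -/
def RegularOpens (X : Type u) [TopologicalSpace X] : Type u := Heyting.Regular (Opens X)

namespace RegularOpens

variable {X : Type u} [TopologicalSpace X]

instance : CompleteBooleanAlgebra (RegularOpens X) :=
  inferInstanceAs (CompleteBooleanAlgebra (Heyting.Regular (Opens X)))

/-- The underlying set of a regular open set. -/
def toSet (U : RegularOpens X) : Set X :=
  ((Heyting.Regular.val (α := Opens X) U : Opens X) : Set X)

theorem isOpen (U : RegularOpens X) : IsOpen U.toSet :=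
  (Heyting.Regular.val (α := Opens X) U).isOpen

theorem toSet_subset {U V : RegularOpens X} : U.toSet ⊆ V.toSet ↔ U ≤ V := Iff.rfl

theorem toSet_injective : Function.Injective (toSet : RegularOpens X → Set X) :=
  fun _ _ h => le_antisymm (toSet_subset.1 h.subset) (toSet_subset.1 h.superset)

@[simp] theorem toSet_bot : (⊥ : RegularOpens X).toSet = ∅ := rfl

@[simp] theorem toSet_inf (U V : RegularOpens X) : (U ⊓ V).toSet = U.toSet ∩ V.toSet := rfl

theorem toSet_compl (U : RegularOpens X) : (Uᶜ).toSet = (closure U.toSet)ᶜ := by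
  rw [← interior_compl]
  exact Opens.coe_compl_eq_interior_compl

theorem interior_closure (U : RegularOpens X) : interior (closure U.toSet) = U.toSet := by
  have h := toSet_compl Uᶜ
  rw [compl_compl, toSet_compl, closure_compl, compl_compl] at h
  exact h.symm

theorem closure_toSet_compl (U : RegularOpens X) : closure (Uᶜ).toSet = (U.toSet)ᶜ := by
  rw [toSet_compl, closure_compl, interior_closure]

theorem toSet_sup (U V : RegularOpens X) :
    (U ⊔ V).toSet = interior (closure (U.toSet ∪ V.toSet)) := by
  rw [← compl_compl (U ⊔ V), compl_sup, toSet_compl, toSet_inf, toSet_compl, toSet_compl,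
    ← compl_union, closure_compl, compl_compl, closure_union]

theorem closure_sup (U V : RegularOpens X) :
    closure (U ⊔ V).toSet = closure U.toSet ∪ closure V.toSet := by
  apply Subset.antisymm
  · rw [toSet_sup, ← closure_union]
    exact closure_minimal interior_subset isClosed_closure
  · exact union_subset (closure_mono (toSet_subset.2 le_sup_left))
      (closure_mono (toSet_subset.2 le_sup_right))

/-- The interior of the closure of an open set, as a regular open set. -/
def ofIsOpen (s : Set X) (hs : IsOpen s) : RegularOpens X :=
  Heyting.Regular.toRegular ⟨s, hs⟩

theorem toSet_ofIsOpen {s : Set X} (hs : IsOpen s) :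
    (ofIsOpen s hs).toSet = interior (closure s) := by
  change (((⟨s, hs⟩ : Opens X)ᶜᶜ : Opens X) : Set X) = _
  rw [Opens.coe_compl_eq_interior_compl, Opens.coe_compl_eq_interior_compl, ← closure_compl,
    compl_compl]
  simp

theorem isCompact_closure_sup {U V : RegularOpens X} (hU : IsCompact (closure U.toSet))
    (hV : IsCompact (closure V.toSet)) : IsCompact (closure (U ⊔ V).toSet) := by
  rw [closure_sup]
  exact hU.union hV

theorem isCompact_closure_mono {U V : RegularOpens X} (h : U ≤ V)
    (hV : IsCompact (closure V.toSet)) : IsCompact (closure U.toSet) :=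
  hV.of_isClosed_subset isClosed_closure (closure_mono (toSet_subset.2 h))

/-! ### The local contact structure of a locally compact Hausdorff space -/

variable [T2Space X] [LocallyCompactSpace X]

/-- A compact set inside an open set is separated from its complement by a relatively compact
regular open set. -/
theorem exists_between {K O : Set X} (hK : IsCompact K) (hO : IsOpen O) (hKO : K ⊆ O) :
    ∃ W : RegularOpens X, K ⊆ W.toSet ∧ closure W.toSet ⊆ O ∧ IsCompact (closure W.toSet) := by
  obtain ⟨V, hV, hKV, hVO, hVc⟩ := exists_open_between_and_isCompact_closure hK hO hKO
  have hcl : closure (ofIsOpen V hV).toSet ⊆ closure V := by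
    rw [toSet_ofIsOpen]
    exact closure_minimal interior_subset isClosed_closure
  refine ⟨ofIsOpen V hV, ?_, hcl.trans hVO, hVc.of_isClosed_subset isClosed_closure hcl⟩
  rw [toSet_ofIsOpen]
  exact hKV.trans (interior_maximal subset_closure hV)

theorem exists_mem_between {x : X} {O : Set X} (hO : IsOpen O) (hx : x ∈ O) :
    ∃ W : RegularOpens X, x ∈ W.toSet ∧ closure W.toSet ⊆ O ∧ IsCompact (closure W.toSet) := by
  simpa using exists_between isCompact_singleton hO (singleton_subset_iff.2 hx)

variable (X) in
/-- The standard local contact structure on the regular open sets of a locally compact Hausdorff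
space: two sets are in contact when their closures meet, and the bounded sets are the relatively
compact ones. -/
def localContact : LocalContact (RegularOpens X) where
  rel U V := (closure U.toSet ∩ closure V.toSet).Nonempty
  isContact :=
    { refl := fun U hU => by
        rw [inter_self, closure_nonempty_iff, nonempty_iff_ne_empty]
        exact fun h => hU (toSet_injective h)
      ne_bot := by
        rintro U V ⟨x, hU, hV⟩
        constructor <;> rintro rfl <;> simp at hU hV
      symm := fun U V h => by rwa [inter_comm]
      sup_iff := fun U V W => by rw [closure_sup, inter_union_distrib_left, union_nonempty] }
  bounded :=
    { carrier := {U | IsCompact (closure U.toSet)}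
      lower' := fun _ _ h hV => isCompact_closure_mono h hV
      nonempty' := ⟨⊥, by simp⟩
      directed' := fun U hU V hV =>
        ⟨U ⊔ V, isCompact_closure_sup hU hV, le_sup_left, le_sup_right⟩ }
  interpolate U hU V h := by
    simp only [NonTangential, closure_toSet_compl, inter_compl_nonempty_iff, not_not] at h ⊢
    obtain ⟨W, hUW, hWV, hW⟩ := exists_between hU V.isOpen h
    exact ⟨W, hW, hUW, hWV⟩
  local_rel := by
    rintro U V ⟨x, hU, hV⟩
    obtain ⟨W, hxW, -, hW⟩ := exists_mem_between isOpen_univ (mem_univ x)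
    exact ⟨W, hW, x, hU, W.isOpen.inter_closure ⟨hxW, hV⟩⟩
  exists_bounded U hU := by
    obtain ⟨x, hx⟩ : U.toSet.Nonempty := by
      rw [nonempty_iff_ne_empty]
      exact fun h => hU (toSet_injective h)
    obtain ⟨W, hxW, hWU, hW⟩ := exists_mem_between U.isOpen hx
    refine ⟨W, hW, ?_, ?_⟩
    · rintro rfl
      exact hxW
    · simpa only [NonTangential, closure_toSet_compl, inter_compl_nonempty_iff, not_not] using hWU

theorem ll_iff {U V : RegularOpens X} : (localContact X).ll U V ↔ closure U.toSet ⊆ V.toSet := by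
  change ¬ (closure U.toSet ∩ closure (Vᶜ).toSet).Nonempty ↔ _
  rw [closure_toSet_compl, inter_compl_nonempty_iff, not_not]

theorem rel_iff {U V : RegularOpens X} :
    (localContact X).rel U V ↔ (closure U.toSet ∩ closure V.toSet).Nonempty := Iff.rfl

theorem mem_bounded_iff {U : RegularOpens X} :
    U ∈ (localContact X).bounded ↔ IsCompact (closure U.toSet) := Iff.rfl

/-! ### Correspondence between `δ`-ideals and open sets -/

/-- The `δ`-ideal of the regular open sets whose closure is compact and contained in a given
open set. -/
def idealOf (O : Set X) (hO : IsOpen O) : DeltaIdeal (localContact X) :=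
  DeltaIdeal.ofSet {U | IsCompact (closure U.toSet) ∧ closure U.toSet ⊆ O}
    (by simp)
    (fun _ _ h hV => ⟨isCompact_closure_mono h hV.1, (closure_mono (toSet_subset.2 h)).trans hV.2⟩)
    (fun U hU V hV => ⟨isCompact_closure_sup hU.1 hV.1, by
      rw [closure_sup]
      exact union_subset hU.2 hV.2⟩)
    (fun _ hU => hU.1)
    (fun U hU => by
      obtain ⟨W, hUW, hWO, hW⟩ := exists_between hU.1 hO hU.2
      exact ⟨W, ⟨hW, hWO⟩, ll_iff.2 hUW⟩)

/-- The union of a `δ`-ideal of regular open sets. -/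
def union (I : DeltaIdeal (localContact X)) : Set X := {x | ∃ U ∈ I, x ∈ U.toSet}

theorem isOpen_union (I : DeltaIdeal (localContact X)) : IsOpen (union I) := by
  rw [isOpen_iff_forall_mem_open]
  rintro x ⟨U, hU, hx⟩
  exact ⟨U.toSet, fun y hy => ⟨U, hU, hy⟩, U.isOpen, hx⟩

theorem union_mono {I J : DeltaIdeal (localContact X)} (h : I ≤ J) : union I ⊆ union J :=
  fun _ ⟨U, hU, hx⟩ => ⟨U, h hU, hx⟩

theorem union_inf (I J : DeltaIdeal (localContact X)) : union (I ⊓ J) = union I ∩ union J := by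
  apply Subset.antisymm
  · exact subset_inter (union_mono inf_le_left) (union_mono inf_le_right)
  · rintro x ⟨⟨U, hU, hx⟩, ⟨V, hV, hx'⟩⟩
    exact ⟨U ⊓ V, ⟨DeltaIdeal.mem_of_le hU inf_le_left, DeltaIdeal.mem_of_le hV inf_le_right⟩,
      hx, hx'⟩

theorem union_idealOf (O : Set X) (hO : IsOpen O) : union (idealOf O hO) = O := by
  ext x
  constructor
  · rintro ⟨U, hU, hx⟩
    exact hU.2 (subset_closure hx)
  · intro hx
    obtain ⟨W, hxW, hWO, hW⟩ := exists_mem_between hO hx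
    exact ⟨W, ⟨hW, hWO⟩, hxW⟩

/-- A `δ`-ideal of regular open sets contains every relatively compact regular open set whose
closure lies in its union. -/
theorem mem_of_closure_subset_union {I : DeltaIdeal (localContact X)} {U : RegularOpens X}
    (hU : IsCompact (closure U.toSet)) (h : closure U.toSet ⊆ union I) : U ∈ I := by
  obtain ⟨W, hW, hUW⟩ : ∃ W ∈ I, closure U.toSet ⊆ W.toSet := by
    have : Nonempty {W // W ∈ I} := ⟨⟨⊥, I.bot_mem⟩⟩
    obtain ⟨W, hW⟩ := hU.elim_directed_cover (fun W : {W // W ∈ I} => W.1.toSet)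
      (fun W => W.1.isOpen)
      (fun x hx => by
        obtain ⟨W, hW, hxW⟩ := h hx
        exact mem_iUnion.2 ⟨⟨W, hW⟩, hxW⟩)
      (fun V W => ⟨⟨V.1 ⊔ W.1, DeltaIdeal.sup_mem V.2 W.2⟩, toSet_subset.2 le_sup_left,
        toSet_subset.2 le_sup_right⟩)
    exact ⟨W.1, W.2, hW⟩
  exact DeltaIdeal.mem_of_le hW (toSet_subset.1 (subset_closure.trans hUW))

/-- One inclusion is compactness applied to the directed cover by members of `I`; the other is the
roundedness of `I`, which puts the closure of a member inside another member. -/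
theorem idealOf_union (I : DeltaIdeal (localContact X)) :
    idealOf (union I) (isOpen_union I) = I := by
  ext U
  constructor
  · rintro ⟨hU, h⟩
    exact mem_of_closure_subset_union hU h
  · intro hU
    obtain ⟨V, hV, hUV⟩ := DeltaIdeal.exists_ll hU
    exact ⟨DeltaIdeal.mem_bounded hU, (ll_iff.1 hUV).trans fun x hx => ⟨V, hV, hx⟩⟩

theorem union_injective :
    Function.Injective (union : DeltaIdeal (localContact X) → Set X) := by
  intro I J h
  rw [← idealOf_union I, ← idealOf_union J]
  congr

/-- The ideal of the open set `union I ∪ union J` bounds both `I` and `J`, hence their join. This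
turns (M5) into a statement about points. -/
theorem union_sup_subset (I J : DeltaIdeal (localContact X)) :
    union (I ⊔ J) ⊆ union I ∪ union J := by
  have h : I ⊔ J ≤ idealOf (union I ∪ union J) ((isOpen_union I).union (isOpen_union J)) := by
    refine sup_le ?_ ?_
    · intro U hU
      rw [← SetLike.mem_coe, SetLike.mem_coe, ← idealOf_union I] at hU
      exact ⟨hU.1, hU.2.trans subset_union_left⟩
    · intro U hU
      rw [← SetLike.mem_coe, SetLike.mem_coe, ← idealOf_union J] at hU
      exact ⟨hU.1, hU.2.trans subset_union_right⟩
  exact (union_mono h).trans (union_idealOf _ _).subset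

end RegularOpens

/-! ### Continuous maps as morphisms -/

namespace RegularOpens

section Preimage

variable {X Y : Type u} [TopologicalSpace X] [T2Space X] [LocallyCompactSpace X]
  [TopologicalSpace Y] [T2Space Y] [LocallyCompactSpace Y]

variable (X) in
/-- The complete local contact algebra of regular open sets of a locally compact Hausdorff
space. -/
abbrev algebra : MDHLC.{u} where
  carrier := RegularOpens X
  loc := localContact X

/-- The morphism of complete local contact algebras induced by a continuous map. -/
def preimageHom (f : X → Y) (hf : Continuous f) : MDHLC.Hom (algebra Y) (algebra X) where
  toFun V := idealOf (f ⁻¹' V.toSet) (V.isOpen.preimage hf)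
  map_inf U V := by
    apply union_injective
    rw [union_inf, union_idealOf, union_idealOf, union_idealOf]
    rfl
  map_eq_iSup V := by
    apply le_antisymm
    · rintro U ⟨hU, hUV⟩
      obtain ⟨W, hUW, hWV, hW⟩ := exists_between (hU.image hf) V.isOpen (image_subset_iff.2 hUV)
      refine (le_iSup₂ (f := fun (b : RegularOpens Y)
        (_ : b ∈ {b | b ∈ (localContact Y).bounded ∧ (localContact Y).ll b V}) =>
        idealOf (f ⁻¹' b.toSet) (b.isOpen.preimage hf)) W ⟨hW, ll_iff.2 hWV⟩) ?_
      exact ⟨hU, image_subset_iff.1 hUW⟩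
    · refine iSup₂_le fun W hW U hU => ⟨hU.1, hU.2.trans (preimage_mono ?_)⟩
      exact subset_closure.trans (ll_iff.1 hW.2)
  map_bot := by
    ext U
    constructor
    · rintro ⟨-, hU⟩
      exact toSet_injective (subset_empty_iff.1 (subset_closure.trans hU))
    · rintro rfl
      exact DeltaIdeal.bot_mem _
  map_sup_le U₁ _ U₂ _ V₁ _ V₂ _ h₁ h₂ := by
    rintro U ⟨hU, hUV⟩
    have hcover : closure U.toSet ⊆ f ⁻¹' V₁.toSet ∪ f ⁻¹' V₂.toSet := by
      intro x hx
      have hx' : f x ∈ closure (U₁ ⊔ U₂ : RegularOpens Y).toSet := subset_closure (hUV hx)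
      rw [closure_sup] at hx'
      exact hx'.imp (fun h => ll_iff.1 h₁ h) (fun h => ll_iff.1 h₂ h)
    -- The compact closure of `U` splits into compact pieces, one in each preimage; thickening each
    -- piece gives a member of each summand, and the two together cover `U`.
    obtain ⟨K₁, K₂, hK₁, hK₂, h1, h2, hK⟩ := hU.binary_compact_cover
      (V₁.isOpen.preimage hf) (V₂.isOpen.preimage hf) hcover
    obtain ⟨W₁, hKW₁, hW₁, hc₁⟩ := exists_between hK₁ (V₁.isOpen.preimage hf) h1
    obtain ⟨W₂, hKW₂, hW₂, hc₂⟩ := exists_between hK₂ (V₂.isOpen.preimage hf) h2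
    refine DeltaIdeal.mem_of_le (DeltaIdeal.mem_sup (a := W₁) (b := W₂) ⟨hc₁, hW₁⟩ ⟨hc₂, hW₂⟩) ?_
    refine toSet_subset.1 ((subset_closure.trans hK.subset).trans (union_subset ?_ ?_))
    · exact hKW₁.trans (toSet_subset.2 le_sup_left)
    · exact hKW₂.trans (toSet_subset.2 le_sup_right)
  exists_mem U hU := by
    obtain ⟨W, hUW, -, hW⟩ := exists_between (IsCompact.image hU hf) isOpen_univ (subset_univ _)
    exact ⟨W, hW, hU, image_subset_iff.1 hUW⟩

theorem union_preimageHom (f : X → Y) (hf : Continuous f) (V : RegularOpens Y) :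
    union ((preimageHom f hf).toFun V) = f ⁻¹' V.toSet :=
  union_idealOf _ (V.isOpen.preimage hf)

/-- The morphism determines the preimages of regular open sets, and these separate the points of
`Y`. -/
theorem preimageHom_injective {f g : X → Y} (hf : Continuous f) (hg : Continuous g)
    (h : preimageHom f hf = preimageHom g hg) : f = g := by
  funext x
  by_contra hne
  obtain ⟨W, hxW, hW, -⟩ := exists_mem_between (isOpen_compl_singleton (x := g x)) hne
  have hx : x ∈ f ⁻¹' W.toSet := hxW
  rw [← union_preimageHom f hf, h, union_preimageHom] at hx
  exact hW (subset_closure hx) rfl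

/-! ### Recovering a continuous map from a morphism -/

section Full

variable (φ : MDHLC.Hom (algebra Y) (algebra X))

theorem exists_isCompact_mem_union (x : X) :
    ∃ V : RegularOpens Y, IsCompact (closure V.toSet) ∧ x ∈ union (φ.toFun V) := by
  obtain ⟨U, hxU, -, hU⟩ := exists_mem_between isOpen_univ (mem_univ x)
  obtain ⟨V, hV, hUV⟩ := φ.exists_mem U hU
  exact ⟨V, hV, U, hUV, hxU⟩

theorem union_map_inf (U V : RegularOpens Y) :
    union (φ.toFun (U ⊓ V)) = union (φ.toFun U) ∩ union (φ.toFun V) := by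
  rw [← union_inf]
  exact congrArg union (φ.map_inf U V)

theorem union_map_bot : union (φ.toFun (⊥ : RegularOpens Y)) = ∅ := by
  rw [eq_empty_iff_forall_notMem]
  rintro x ⟨U, hU, hx⟩
  have hU' : U ∈ (φ.toFun ⊥ : Set (algebra X).carrier) := hU
  rw [φ.map_bot] at hU'
  rw [mem_singleton_iff.1 hU'] at hx
  exact hx

/-- The point of `Y` determined by a point of `X` and a morphism of the algebras of regular open
sets. -/
theorem exists_mem_closure (x : X) :
    ∃ y : Y, ∀ V : RegularOpens Y, x ∈ union (φ.toFun V) → y ∈ closure V.toSet := by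
  obtain ⟨V₀, hV₀, hx₀⟩ := exists_isCompact_mem_union φ x
  -- Restricting to sets below `V₀` makes the closures compact. The family is directed by (M2), and
  -- its members are nonempty by (M4).
  let ι := {V : RegularOpens Y // V ≤ V₀ ∧ x ∈ union (φ.toFun V)}
  have : Nonempty ι := ⟨⟨V₀, le_rfl, hx₀⟩⟩
  obtain ⟨y, hy⟩ := IsCompact.nonempty_iInter_of_directed_nonempty_isCompact_isClosed
    (fun V : ι => closure V.1.toSet)
    (fun V W => ⟨⟨V.1 ⊓ W.1, inf_le_left.trans V.2.1, by
      rw [union_map_inf]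
      exact ⟨V.2.2, W.2.2⟩⟩, closure_mono (toSet_subset.2 inf_le_left),
      closure_mono (toSet_subset.2 inf_le_right)⟩)
    (fun V => by
      rw [closure_nonempty_iff, nonempty_iff_ne_empty]
      intro h
      have hx := V.2.2
      rw [toSet_injective (h.trans toSet_bot.symm), union_map_bot] at hx
      exact hx)
    (fun V => isCompact_closure_mono V.2.1 hV₀) (fun V => isClosed_closure)
  refine ⟨y, fun V hV => ?_⟩
  -- An arbitrary `V` is brought into the family by meeting it with `V₀`.
  have hmem : x ∈ union (φ.toFun (V ⊓ V₀)) := by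
    rw [union_map_inf]
    exact ⟨hV, hx₀⟩
  exact closure_mono (toSet_subset.2 inf_le_left) (mem_iInter.1 hy ⟨V ⊓ V₀, inf_le_right, hmem⟩)

/-- From left to right, (M3) shrinks `V` to some `W ≪ V` still seen by `x`, so `y ∈ closure W ⊆ V`.
Conversely, a bounded set seen by `x` is cut into a part near `y` and a part away from `y`; (M5)
puts `x` in the open set of an enlargement of one of them, and the part away is excluded by the
choice of `y`. -/
theorem mem_union_iff_of_forall_mem_closure {x : X} {y : Y}
    (hy : ∀ V : RegularOpens Y, x ∈ union (φ.toFun V) → y ∈ closure V.toSet)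
    (V : RegularOpens Y) : x ∈ union (φ.toFun V) ↔ y ∈ V.toSet := by
  constructor
  · rintro ⟨U, hU, hx⟩
    obtain ⟨W, hW, hUW⟩ := φ.mem_iff.1 hU
    exact ll_iff.1 hW.2 (hy W ⟨U, hUW, hx⟩)
  · intro hyV
    obtain ⟨V₀, hV₀, hx₀⟩ := exists_isCompact_mem_union φ x
    obtain ⟨V₁, hV₀₁, -, hV₁⟩ := exists_between hV₀ isOpen_univ (subset_univ _)
    -- In the chain `W₃ ≪ W₂ ≪ W₁ ≪ V` around `y`, the middle set cuts `V₀` in two, while `W₁` and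
    -- `W₃ᶜ` give the room that (M5) demands on either side of the cut.
    obtain ⟨W₁, hyW₁, hW₁V, hW₁⟩ := exists_mem_between V.isOpen hyV
    obtain ⟨W₂, hyW₂, hW₂₁, hW₂⟩ := exists_mem_between W₁.isOpen hyW₁
    obtain ⟨W₃, hyW₃, hW₃₂, hW₃⟩ := exists_mem_between W₂.isOpen hyW₂
    have hle : φ.toFun (W₂ ⊔ V₀ ⊓ W₂ᶜ) ≤ φ.toFun W₁ ⊔ φ.toFun (V₁ ⊓ W₃ᶜ) := by
      refine φ.map_sup_le W₂ hW₂ (V₀ ⊓ W₂ᶜ) (isCompact_closure_mono inf_le_left hV₀) W₁ hW₁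
        (V₁ ⊓ W₃ᶜ) (isCompact_closure_mono inf_le_left hV₁) (ll_iff.2 hW₂₁) (ll_iff.2 ?_)
      rw [toSet_inf, toSet_inf]
      refine (closure_inter_subset_inter_closure _ _).trans (inter_subset_inter hV₀₁ ?_)
      rw [closure_toSet_compl, toSet_compl]
      exact compl_subset_compl.2 hW₃₂
    have hV₀le : V₀ ≤ W₂ ⊔ V₀ ⊓ W₂ᶜ := by
      rw [sup_inf_left, sup_compl_eq_top, inf_top_eq]
      exact le_sup_right
    rcases union_sup_subset _ _ (union_mono hle (union_mono (φ.mono hV₀le) hx₀)) with h | h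
    · exact union_mono (φ.mono (toSet_subset.1 (subset_closure.trans hW₁V))) h
    -- Here `y` would lie in the closure of `W₃ᶜ`, which is the set complement of `W₃`.
    · have hy' := closure_mono (toSet_subset.2 inf_le_right) (hy _ h)
      rw [closure_toSet_compl] at hy'
      exact absurd hyW₃ hy'

theorem exists_preimageHom_eq : ∃ (f : X → Y) (hf : Continuous f), preimageHom f hf = φ := by
  choose f hf using exists_mem_closure φ
  have key := fun x => mem_union_iff_of_forall_mem_closure φ (hf x)
  have hpre : ∀ V : RegularOpens Y, f ⁻¹' V.toSet = union (φ.toFun V) := fun V => by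
    ext x
    exact (key x V).symm
  have hcont : Continuous f := by
    refine continuous_def.2 fun O hO => isOpen_iff_forall_mem_open.2 fun x hx => ?_
    obtain ⟨W, hxW, hWO, -⟩ := exists_mem_between hO hx
    refine ⟨f ⁻¹' W.toSet, preimage_mono (subset_closure.trans hWO), ?_, hxW⟩
    rw [hpre]
    exact isOpen_union _
  refine ⟨f, hcont, MDHLC.Hom.ext fun V => union_injective ?_⟩
  rw [← hpre V]
  exact union_preimageHom f hcont V

end Full

end Preimage

end RegularOpens

/-! ### The regular open functor, full and faithful -/

namespace HLC

instance (X : HLC.{u}) : T2Space X.obj := X.property.1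

instance (X : HLC.{u}) : LocallyCompactSpace X.obj := X.property.2

/-- The contravariant functor of regular open sets. -/
def regularOpens : HLC.{u}ᵒᵖ ⥤ MDHLC.{u} where
  obj X := RegularOpens.algebra X.unop.obj
  map f := RegularOpens.preimageHom f.unop.hom f.unop.hom.hom.continuous
  map_id X := MDHLC.Hom.ext fun V => by
    ext U
    change _ ↔ U ∈ DeltaIdeal.principal (RegularOpens.localContact X.unop.obj) V
    rw [DeltaIdeal.mem_principal, RegularOpens.ll_iff]
    rfl
  map_comp {X Y Z} f g := MDHLC.Hom.ext fun V => by
    ext U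
    refine Iff.trans ?_ MDHLC.Hom.mem_comp.symm
    constructor
    · rintro ⟨hU, hUV⟩
      -- The image of `closure U` is compact, so a bounded `W` fits between it and the preimage of
      -- `V`; this `W` witnesses membership in the join defining the composite.
      obtain ⟨W, hUW, hWV, hW⟩ := RegularOpens.exists_between
        (hU.image g.unop.hom.hom.continuous)
        ((RegularOpens.isOpen V).preimage f.unop.hom.hom.continuous) (image_subset_iff.2 hUV)
      exact ⟨W, ⟨hW, hWV⟩, hU, image_subset_iff.1 hUW⟩
    · rintro ⟨W, ⟨hW, hWV⟩, hU, hUW⟩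
      exact ⟨hU, hUW.trans (preimage_mono (subset_closure.trans hWV))⟩

instance : regularOpens.{u}.Faithful where
  map_injective {X Y f g} h := by
    apply Quiver.Hom.unop_inj
    ext x
    exact congrFun (RegularOpens.preimageHom_injective f.unop.hom.hom.continuous
      g.unop.hom.hom.continuous h) x

instance : regularOpens.{u}.Full where
  map_surjective {X Y} φ := by
    obtain ⟨f, hf, h⟩ := RegularOpens.exists_preimageHom_eq φ
    exact ⟨(ObjectProperty.homMk (TopCat.ofHom ⟨f, hf⟩)).op, h⟩

end HLC

/-! ### Points of the dual space: rounded decisive filters -/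

namespace LocalContact

variable {B : Type u} [BooleanAlgebra B] {L : LocalContact B}

theorem ll_compl {a b : B} (h : L.ll a b) : L.ll bᶜ aᶜ := by
  intro h'
  rw [compl_compl] at h'
  exact h (L.isContact.symm _ _ h')

/-- A proper filter with a bounded element that decides every pair `r ≪ s` with `r` bounded. -/
structure IsDecisive (L : LocalContact B) (p : Set B) : Prop where
  upper : ∀ a ∈ p, ∀ b, a ≤ b → b ∈ p
  inf_mem : ∀ a ∈ p, ∀ b ∈ p, a ⊓ b ∈ p
  bot_notMem : ⊥ ∉ p
  exists_bounded : ∃ a ∈ p, a ∈ L.bounded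
  mem_or_compl_mem : ∀ r ∈ L.bounded, ∀ s, L.ll r s → s ∈ p ∨ rᶜ ∈ p

end LocalContact

/-- The points of the dual space of a local contact algebra: the decisive filters that are
rounded. -/
structure ContactEnd {B : Type u} [BooleanAlgebra B] (L : LocalContact B) where
  /-- the underlying filter -/
  filter : Set B
  isDecisive : L.IsDecisive filter
  exists_ll_mem : ∀ a ∈ filter, ∃ b ∈ filter, b ∈ L.bounded ∧ L.ll b a

namespace ContactEnd

open LocalContact

section BooleanAlgebra

variable {B : Type u} [BooleanAlgebra B] {L : LocalContact B}

theorem filter_injective : Function.Injective (filter : ContactEnd L → Set B) := by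
  rintro ⟨p, _, _⟩ ⟨q, _, _⟩ h
  cases h
  rfl

theorem mem_of_le {x : ContactEnd L} {a b : B} (ha : a ∈ x.filter) (hab : a ≤ b) :
    b ∈ x.filter := x.isDecisive.upper a ha b hab

theorem inf_mem {x : ContactEnd L} {a b : B} (ha : a ∈ x.filter) (hb : b ∈ x.filter) :
    a ⊓ b ∈ x.filter := x.isDecisive.inf_mem a ha b hb

theorem disjoint_notMem {x : ContactEnd L} {a b : B} (ha : a ∈ x.filter) (h : a ⊓ b = ⊥) :
    b ∉ x.filter := fun hb => x.isDecisive.bot_notMem (h ▸ inf_mem ha hb)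

theorem top_mem (x : ContactEnd L) : ⊤ ∈ x.filter :=
  let ⟨_, ha, _⟩ := x.isDecisive.exists_bounded
  mem_of_le ha le_top

/-- The boundedness restriction disappears by cutting `a` with a bounded member `d` of the filter:
`(a ⊓ d)ᶜ ⊓ d ≤ aᶜ`. -/
theorem mem_or_compl_mem (x : ContactEnd L) {a b : B} (h : L.ll a b) :
    b ∈ x.filter ∨ aᶜ ∈ x.filter := by
  obtain ⟨d, hd, hdb⟩ := x.isDecisive.exists_bounded
  refine (x.isDecisive.mem_or_compl_mem (a ⊓ d) (L.bounded.lower inf_le_right hdb) b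
    (ll_mono h inf_le_left le_rfl)).imp_right fun h' => ?_
  refine mem_of_le (inf_mem h' hd) ?_
  rw [compl_inf, inf_sup_right, compl_inf_eq_bot, sup_bot_eq]
  exact inf_le_left

/-- The rounding of a decisive filter. -/
def ofDecisive (p : Set B) (hp : L.IsDecisive p) : ContactEnd L where
  filter := {b | ∃ c ∈ p, c ∈ L.bounded ∧ L.ll c b}
  isDecisive :=
    { upper := fun a ⟨c, hc, hcb, hca⟩ b hab => ⟨c, hc, hcb, ll_mono hca le_rfl hab⟩
      inf_mem := fun a ⟨c, hc, hcb, hca⟩ b ⟨d, hd, hdb, hdb'⟩ =>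
        ⟨c ⊓ d, hp.inf_mem c hc d hd, L.bounded.lower inf_le_left hcb,
          ll_inf (ll_mono hca inf_le_left le_rfl) (ll_mono hdb' inf_le_right le_rfl)⟩
      bot_notMem := fun ⟨c, hc, _, h⟩ => hp.bot_notMem (le_bot_iff.1 (ll_le h) ▸ hc)
      exists_bounded := by
        obtain ⟨a, ha, hab⟩ := hp.exists_bounded
        obtain ⟨b, hb, h, -⟩ := L.interpolate a hab ⊤ (ll_top a)
        exact ⟨b, ⟨a, ha, hab, h⟩, hb⟩
      mem_or_compl_mem := by
        intro r hr s hrs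
        obtain ⟨t, ht, hrt, hts⟩ := L.interpolate r hr s hrs
        -- With `r ≪ q ≪ t ≪ s`, deciding the middle pair leaves a gap on each side, so whichever of
        -- `t`, `qᶜ` lies in `p` witnesses the rounded alternative.
        obtain ⟨q, hq, hrq, hqt⟩ := L.interpolate r hr t hrt
        obtain ⟨d, hd, hdb⟩ := hp.exists_bounded
        refine (hp.mem_or_compl_mem q hq t hqt).imp (fun h => ⟨t, h, ht, hts⟩) fun h => ?_
        exact ⟨qᶜ ⊓ d, hp.inf_mem _ h _ hd, L.bounded.lower inf_le_right hdb,
          ll_mono (ll_compl hrq) inf_le_left le_rfl⟩ }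
  exists_ll_mem := by
    rintro a ⟨c, hc, hcb, hca⟩
    obtain ⟨b, hb, h1, h2⟩ := L.interpolate c hcb a hca
    exact ⟨b, ⟨c, hc, hcb, h1⟩, hb, h2⟩

/-- The complement of a prime ideal missing a bounded element is decisive. -/
theorem isDecisive_compl {J : Order.Ideal B} (hJ : J.IsPrime) {a : B} (ha : a ∉ J)
    (hab : a ∈ L.bounded) : L.IsDecisive (J : Set B)ᶜ where
  upper _ hx _ hxy hy := hx (J.lower hxy hy)
  inf_mem _ hx _ hy h := (hJ.mem_or_mem h).elim hx hy
  bot_notMem h := h J.bot_mem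
  exists_bounded := ⟨a, ha, hab⟩
  mem_or_compl_mem r _ s hrs := by
    by_contra! h
    have hs : s ∈ J := not_not.1 h.1
    have hr : rᶜ ∈ J := not_not.1 h.2
    have htop : (⊤ : B) ∈ J := by
      rw [← sup_compl_eq_top (x := r)]
      exact Order.Ideal.sup_mem (J.lower (ll_le hrs) hs) hr
    exact ha (J.lower le_top htop)

/-- Two elements in contact, one of them bounded, have a common adherent point. -/
theorem exists_of_rel {a c : B} (ha : a ∈ L.bounded) (h : L.rel a c) :
    ∃ x : ContactEnd L, aᶜ ∉ x.filter ∧ cᶜ ∉ x.filter := by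
  let I : Order.Ideal B :=
    { carrier := {b | L.ll b cᶜ}
      lower' := fun _ _ hxy hx => ll_mono hx hxy le_rfl
      nonempty' := ⟨⊥, bot_ll _⟩
      directed' := fun x hx y hy => ⟨x ⊔ y, ll_sup_left hx hy, le_sup_left, le_sup_right⟩ }
  -- A common element would give `a ≪ cᶜ`, against the contact of `a` and `c`. A prime ideal
  -- containing `I` and avoiding `a` then yields the point.
  have hdisj : Disjoint (Order.PFilter.principal a : Set B) (I : Set B) := by
    rw [Set.disjoint_left]
    intro b hb hbI
    have hab : a ≤ b := hb
    have hac : L.ll a cᶜ := ll_mono hbI hab le_rfl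
    apply hac
    rwa [compl_compl]
  obtain ⟨J, hJ, hIJ, hJa⟩ := DistribLattice.prime_ideal_of_disjoint_filter_ideal hdisj
  have haJ : a ∉ J := Set.disjoint_left.1 hJa (le_refl a : a ≤ a)
  refine ⟨ofDecisive _ (isDecisive_compl hJ haJ ha), ?_, ?_⟩
  · rintro ⟨d, hd, -, hda⟩
    have haJ' : aᶜ ∉ J := fun h => hd (J.lower (ll_le hda) h)
    have := hJ.mem_or_compl_mem (x := a)
    tauto
  · rintro ⟨d, hd, -, hdc⟩
    exact hd (hIJ hdc)

/-- (BC3) gives a nonzero bounded `b ≪ a`. A point adherent to `b` omits `bᶜ`, so it must contain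
`a`. -/
theorem exists_mem {a : B} (ha : a ≠ ⊥) : ∃ x : ContactEnd L, a ∈ x.filter := by
  obtain ⟨b, hb, hb0, hba⟩ := L.exists_bounded a ha
  obtain ⟨x, hx, -⟩ := exists_of_rel hb (L.isContact.refl b hb0)
  exact ⟨x, (x.mem_or_compl_mem hba).resolve_right hx⟩

/-- The basic open set of the points containing a given element. -/
def basic (L : LocalContact B) (a : B) : Set (ContactEnd L) := {x | a ∈ x.filter}

theorem basic_mono {a b : B} (h : a ≤ b) : basic L a ⊆ basic L b := fun _ hx => mem_of_le hx h

theorem basic_inf (a b : B) : basic L (a ⊓ b) = basic L a ∩ basic L b := by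
  ext x
  exact ⟨fun h => ⟨mem_of_le h inf_le_left, mem_of_le h inf_le_right⟩, fun h => inf_mem h.1 h.2⟩

theorem basic_bot : basic L ⊥ = ∅ := eq_empty_of_forall_notMem fun x => x.isDecisive.bot_notMem

theorem basic_subset_basic {a b : B} : basic L a ⊆ basic L b ↔ a ≤ b := by
  refine ⟨fun h => ?_, basic_mono⟩
  by_contra hab
  have h0 : a ⊓ bᶜ ≠ ⊥ := fun h0 => hab (disjoint_compl_right_iff.1 (disjoint_iff.2 h0))
  obtain ⟨x, hx⟩ := exists_mem (L := L) h0
  exact disjoint_notMem (h (mem_of_le hx inf_le_left)) inf_compl_eq_bot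
    (mem_of_le hx inf_le_right)

/-! ### Topology of the dual space -/

instance : TopologicalSpace (ContactEnd L) := generateFrom (range (basic L))

theorem isTopologicalBasis : IsTopologicalBasis (range (basic L)) where
  exists_subset_inter := by
    rintro _ ⟨a, rfl⟩ _ ⟨b, rfl⟩ x hx
    exact ⟨_, ⟨a ⊓ b, rfl⟩, inf_mem hx.1 hx.2, (basic_inf a b).subset⟩
  sUnion_eq := eq_univ_of_forall fun x => ⟨_, ⟨⊤, rfl⟩, x.top_mem⟩
  eq_generateFrom := rfl

theorem isOpen_basic (a : B) : IsOpen (basic L a) := isTopologicalBasis.isOpen ⟨a, rfl⟩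

theorem exists_basic_subset {x : ContactEnd L} {s : Set (ContactEnd L)} (hs : IsOpen s)
    (hx : x ∈ s) : ∃ a ∈ x.filter, basic L a ⊆ s := by
  obtain ⟨_, ⟨a, rfl⟩, ha, has⟩ := isTopologicalBasis.exists_subset_of_mem_open hx hs
  exact ⟨a, ha, has⟩

/-- If `aᶜ` is not in `x`, no `b` in `x` is disjoint from `a`, so every basic neighbourhood of `x`
meets the basic set of `a` by `exists_mem`. -/
theorem closure_basic (a : B) : closure (basic L a) = (basic L aᶜ)ᶜ := by
  apply Subset.antisymm
  · refine closure_minimal (fun x hx => disjoint_notMem hx inf_compl_eq_bot) ?_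
    exact (isOpen_basic _).isClosed_compl
  · intro x hx
    rw [mem_closure_iff]
    intro s hs hxs
    obtain ⟨b, hb, hbs⟩ := exists_basic_subset hs hxs
    have h0 : b ⊓ a ≠ ⊥ := fun h0 =>
      hx (mem_of_le hb (le_compl_iff_disjoint_right.2 (disjoint_iff.2 h0)))
    obtain ⟨y, hy⟩ := exists_mem (L := L) h0
    exact ⟨y, hbs (mem_of_le hy inf_le_left), mem_of_le hy inf_le_right⟩

theorem interior_closure_basic (a : B) : interior (closure (basic L a)) = basic L a := by
  rw [closure_basic, interior_compl, closure_basic, compl_compl, compl_compl]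

theorem closure_basic_subset {a b : B} (h : L.ll a b) : closure (basic L a) ⊆ basic L b := by
  rw [closure_basic]
  exact fun x hx => (x.mem_or_compl_mem h).resolve_right hx

theorem closure_inter_nonempty_iff {a b : B} :
    (closure (basic L a) ∩ closure (basic L b)).Nonempty ↔ L.rel a b := by
  constructor
  · rintro ⟨x, hxa, hxb⟩
    by_contra h
    have hll : L.ll a bᶜ := fun h' => h (by rwa [compl_compl] at h')
    rw [closure_basic] at hxb
    exact hxb (closure_basic_subset hll hxa)
  · intro h
    -- (BC2) replaces `a` by the bounded `d ⊓ a`, as the prime ideal argument needs a bounded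
    -- element.
    obtain ⟨d, hd, hda⟩ := L.local_rel b a (L.isContact.symm _ _ h)
    obtain ⟨x, hxa, hxb⟩ := exists_of_rel (L.bounded.lower inf_le_left hd)
      (L.isContact.symm _ _ hda)
    rw [closure_basic, closure_basic]
    exact ⟨x, fun hx => hxa (mem_of_le hx (compl_le_compl inf_le_right)), hxb⟩

theorem isCompact_closure_basic {a : B} (ha : a ∈ L.bounded) :
    IsCompact (closure (basic L a)) := by
  rw [isCompact_iff_ultrafilter_le_nhds']
  intro F hF
  obtain ⟨d, hd, had, -⟩ := L.interpolate a ha ⊤ (ll_top a)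
  -- The limit of `F` is the rounding of this trace. An ultrafilter contains the closure of the
  -- basic set of `r` or its complement, the basic set of `rᶜ`, which makes the trace decisive.
  have hp : L.IsDecisive {c | basic L c ∈ F} :=
    { upper := fun c hc e hce => Filter.mem_of_superset hc (basic_mono hce)
      inf_mem := fun c hc e he => by
        rw [mem_ofPred_eq, basic_inf]
        exact Filter.inter_mem hc he
      bot_notMem := fun h => by
        rw [mem_ofPred_eq, basic_bot] at h
        exact F.empty_notMem h
      exists_bounded := ⟨d, Filter.mem_of_superset hF (closure_basic_subset had), hd⟩
      mem_or_compl_mem := fun r _ s hrs => by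
        rcases Ultrafilter.mem_or_compl_mem F (closure (basic L r)) with h | h
        · exact Or.inl (Filter.mem_of_superset h (closure_basic_subset hrs))
        · rw [closure_basic, compl_compl] at h
          exact Or.inr h }
  have hle : (F : Filter (ContactEnd L)) ≤ nhds (ofDecisive _ hp) := by
    intro s hs
    obtain ⟨t, hts, ht, hxt⟩ := mem_nhds_iff.1 hs
    obtain ⟨b, ⟨c, hc, -, hcb⟩, hbt⟩ := exists_basic_subset ht hxt
    exact Filter.mem_of_superset hc ((basic_mono (ll_le hcb)).trans (hbt.trans hts))
  exact ⟨_, isClosed_closure.mem_of_frequently_of_tendsto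
    (f := id) (Filter.Eventually.frequently hF) hle, hle⟩

/-- Every point contains a bounded element, so the basic sets of bounded elements form a directed
open cover and a single one contains the compact closure. -/
theorem mem_bounded_of_isCompact {a : B} (h : IsCompact (closure (basic L a))) :
    a ∈ L.bounded := by
  have : Nonempty {b // b ∈ L.bounded} := ⟨⟨⊥, Order.Ideal.bot_mem _⟩⟩
  obtain ⟨b, hb⟩ := h.elim_directed_cover (fun b : {b // b ∈ L.bounded} => basic L b.1)
    (fun b => isOpen_basic _)
    (fun x _ => by
      obtain ⟨b, hb, hbb⟩ := x.isDecisive.exists_bounded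
      exact mem_iUnion.2 ⟨⟨b, hbb⟩, hb⟩)
    (fun b c => ⟨⟨b.1 ⊔ c.1, Order.Ideal.sup_mem b.2 c.2⟩, basic_mono le_sup_left,
      basic_mono le_sup_right⟩)
  exact L.bounded.lower (basic_subset_basic.1 (subset_closure.trans hb)) b.2

/-- Points are maximal: for `c ≪ b` with `c` in the larger filter, the smaller one contains `b` or
`cᶜ`, and `cᶜ` would clash with `c`. -/
theorem eq_of_filter_subset {x y : ContactEnd L} (h : x.filter ⊆ y.filter) : x = y := by
  refine filter_injective (h.antisymm fun b hb => ?_)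
  obtain ⟨c, hc, -, hcb⟩ := y.exists_ll_mem b hb
  exact (x.mem_or_compl_mem hcb).resolve_right fun h' => disjoint_notMem hc inf_compl_eq_bot (h h')

instance : T2Space (ContactEnd L) where
  t2 x y hxy := by
    obtain ⟨b, hbx, hby⟩ := not_subset.1 (mt eq_of_filter_subset hxy)
    obtain ⟨c, hc, -, hcb⟩ := x.exists_ll_mem b hbx
    refine ⟨basic L c, basic L cᶜ, isOpen_basic c, isOpen_basic cᶜ, hc,
      (y.mem_or_compl_mem hcb).resolve_left hby, ?_⟩
    rw [Set.disjoint_iff_inter_eq_empty, ← basic_inf, inf_compl_eq_bot, basic_bot]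

instance : LocallyCompactSpace (ContactEnd L) where
  local_compact_nhds x n hn := by
    obtain ⟨s, hsn, hs, hxs⟩ := mem_nhds_iff.1 hn
    obtain ⟨a, ha, has⟩ := exists_basic_subset hs hxs
    obtain ⟨b, hb, hbb, hba⟩ := x.exists_ll_mem a ha
    exact ⟨closure (basic L b),
      Filter.mem_of_superset ((isOpen_basic b).mem_nhds hb) subset_closure,
      (closure_basic_subset hba).trans (has.trans hsn), isCompact_closure_basic hbb⟩

end BooleanAlgebra

/-! ### Representation of complete algebras -/

section Complete

variable {B : Type u} [CompleteBooleanAlgebra B] (L : LocalContact B)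

/-- The witness is the join of all `b` whose basic set lies in `s`. By infinite distributivity, any
element meeting this join meets one such `b`, so the basic set of the join lies in `closure s`, and
regularity of `s` places it inside `s`. -/
theorem exists_basic_eq {s : Set (ContactEnd L)} (hs : interior (closure s) = s) :
    ∃ a, basic L a = s := by
  have hso : IsOpen s := hs ▸ isOpen_interior
  refine ⟨sSup {b | basic L b ⊆ s}, Subset.antisymm ?_ ?_⟩
  · refine (interior_maximal (fun x hx => mem_closure_iff.2 fun t ht hxt => ?_)
      (isOpen_basic _)).trans hs.subset
    obtain ⟨c, hc, hct⟩ := exists_basic_subset ht hxt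
    have h0 : ∃ b, basic L b ⊆ s ∧ c ⊓ b ≠ ⊥ := by
      by_contra! h
      refine disjoint_notMem hc ?_ hx
      rw [inf_sSup_eq, iSup₂_eq_bot]
      exact h
    obtain ⟨b, hb, h0⟩ := h0
    obtain ⟨y, hy⟩ := exists_mem (L := L) h0
    exact ⟨y, hct (mem_of_le hy inf_le_left), hb (mem_of_le hy inf_le_right)⟩
  · intro x hx
    obtain ⟨a, ha, has⟩ := exists_basic_subset hso hx
    exact mem_of_le ha (le_sSup has)

/-- A complete local contact algebra is isomorphic to the algebra of regular open sets of its dual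
space. -/
noncomputable def orderIso : B ≃o RegularOpens (ContactEnd L) :=
  RelIso.ofSurjective
    (r := (· ≤ ·)) (s := (· ≤ ·))
    (OrderEmbedding.ofMapLEIff
      (fun a => RegularOpens.ofIsOpen (basic L a) (isOpen_basic a)) fun a b => by
        rw [← RegularOpens.toSet_subset, RegularOpens.toSet_ofIsOpen, RegularOpens.toSet_ofIsOpen,
          interior_closure_basic, interior_closure_basic, basic_subset_basic])
    (fun U => by
      obtain ⟨a, ha⟩ := exists_basic_eq L U.interior_closure
      refine ⟨a, RegularOpens.toSet_injective ?_⟩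
      change (RegularOpens.ofIsOpen (basic L a) (isOpen_basic a)).toSet = _
      rw [RegularOpens.toSet_ofIsOpen, interior_closure_basic, ha])

theorem toSet_orderIso (a : B) : (orderIso L a).toSet = basic L a := by
  change (RegularOpens.ofIsOpen (basic L a) (isOpen_basic a)).toSet = _
  rw [RegularOpens.toSet_ofIsOpen, interior_closure_basic]

theorem rel_orderIso (a b : B) :
    (RegularOpens.localContact (ContactEnd L)).rel (orderIso L a) (orderIso L b) ↔ L.rel a b := by
  rw [RegularOpens.rel_iff, toSet_orderIso, toSet_orderIso, closure_inter_nonempty_iff]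

theorem orderIso_mem_bounded (a : B) :
    orderIso L a ∈ (RegularOpens.localContact (ContactEnd L)).bounded ↔ a ∈ L.bounded := by
  rw [RegularOpens.mem_bounded_iff, toSet_orderIso]
  exact ⟨mem_bounded_of_isCompact, isCompact_closure_basic⟩

end Complete

end ContactEnd

/-! ### Isomorphisms of algebras as isomorphisms of the category -/

namespace MDHLC

variable {A B : MDHLC.{u}}

/-- The morphism induced by an order isomorphism that preserves contact and boundedness. -/
def homOfOrderIso (e : A.carrier ≃o B.carrier)
    (hll : ∀ a b, B.loc.ll (e a) (e b) ↔ A.loc.ll a b)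
    (hb : ∀ a, e a ∈ B.loc.bounded ↔ a ∈ A.loc.bounded) : Hom A B where
  toFun a := DeltaIdeal.principal B.loc (e a)
  map_inf a b := by
    rw [e.map_inf]
    exact (Hom.id B).map_inf (e a) (e b)
  map_eq_iSup a := by
    apply le_antisymm
    · rintro x ⟨hx, h⟩
      obtain ⟨b, hbb, h1, h2⟩ := B.loc.interpolate x hx (e a) h
      obtain ⟨c, rfl⟩ := e.surjective b
      exact (le_iSup₂ (f := fun b (_ : b ∈ {b | b ∈ A.loc.bounded ∧ A.loc.ll b a}) =>
        DeltaIdeal.principal B.loc (e b)) c ⟨(hb c).1 hbb, (hll c a).1 h2⟩) ⟨hx, h1⟩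
    · exact iSup₂_le fun b h => DeltaIdeal.principal_mono (e.monotone (LocalContact.ll_le h.2))
  map_bot := by
    rw [e.map_bot]
    exact (Hom.id B).map_bot
  map_sup_le a₁ h₁ a₂ h₂ b₁ k₁ b₂ k₂ hab₁ hab₂ := by
    rw [e.map_sup]
    exact (Hom.id B).map_sup_le _ ((hb _).2 h₁) _ ((hb _).2 h₂) _ ((hb _).2 k₁) _ ((hb _).2 k₂)
      ((hll _ _).2 hab₁) ((hll _ _).2 hab₂)
  exists_mem b h := by
    obtain ⟨c, hc, hbc⟩ := (Hom.id B).exists_mem b h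
    obtain ⟨a, rfl⟩ := e.surjective c
    exact ⟨a, (hb a).1 hc, hbc⟩

/-- Up to transport along `e` this is the idempotence of the identity `a ↦ I_a`, where (BC1)
supplies the intermediate element. -/
theorem homOfOrderIso_comp_symm (e : A.carrier ≃o B.carrier)
    (hll : ∀ a b, B.loc.ll (e a) (e b) ↔ A.loc.ll a b)
    (hb : ∀ a, e a ∈ B.loc.bounded ↔ a ∈ A.loc.bounded)
    (hll' : ∀ a b, A.loc.ll (e.symm a) (e.symm b) ↔ B.loc.ll a b)
    (hb' : ∀ a, e.symm a ∈ A.loc.bounded ↔ a ∈ B.loc.bounded) :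
    Hom.comp (homOfOrderIso e hll hb) (homOfOrderIso e.symm hll' hb') = Hom.id A := by
  refine Hom.ext fun a => DeltaIdeal.ext fun x => Hom.mem_comp.trans ?_
  constructor
  · rintro ⟨b, ⟨hbb, hba⟩, hx, hxb⟩
    refine ⟨hx, LocalContact.ll_mono hxb le_rfl ?_⟩
    rw [← e.symm_apply_apply a]
    exact e.symm.monotone (LocalContact.ll_le hba)
  · rintro ⟨hx, hxa⟩
    obtain ⟨y, hy, hxy, hya⟩ := A.loc.interpolate x hx a hxa
    refine ⟨e y, ⟨(hb y).2 hy, (hll y a).2 hya⟩, hx, ?_⟩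
    rwa [e.symm_apply_apply]

/-- An order isomorphism that preserves contact and boundedness is an isomorphism of complete local
contact algebras. -/
def isoOfOrderIso (e : A.carrier ≃o B.carrier)
    (hrel : ∀ a b, B.loc.rel (e a) (e b) ↔ A.loc.rel a b)
    (hb : ∀ a, e a ∈ B.loc.bounded ↔ a ∈ A.loc.bounded) : A ≅ B :=
  have hll : ∀ a b, B.loc.ll (e a) (e b) ↔ A.loc.ll a b := fun a b => by
    unfold LocalContact.ll NonTangential
    rw [← map_compl' e, hrel]
  have hll' : ∀ a b, A.loc.ll (e.symm a) (e.symm b) ↔ B.loc.ll a b := fun a b => by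
    rw [← hll, e.apply_symm_apply, e.apply_symm_apply]
  have hb' : ∀ a, e.symm a ∈ A.loc.bounded ↔ a ∈ B.loc.bounded := fun a => by
    rw [← hb, e.apply_symm_apply]
  { hom := homOfOrderIso e hll hb
    inv := homOfOrderIso e.symm hll' hb'
    hom_inv_id := homOfOrderIso_comp_symm e hll hb hll' hb'
    inv_hom_id := homOfOrderIso_comp_symm e.symm hll' hb' hll hb }

end MDHLC

/-! ### Essential surjectivity and the equivalence -/

namespace HLC

/-- The dual space of a complete local contact algebra. -/
def dualSpace (A : MDHLC.{u}) : HLC.{u} where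
  obj := TopCat.of (ContactEnd A.loc)
  property := ⟨inferInstanceAs (T2Space (ContactEnd A.loc)),
    inferInstanceAs (LocallyCompactSpace (ContactEnd A.loc))⟩

instance : regularOpens.{u}.EssSurj where
  mem_essImage A := ⟨Opposite.op (dualSpace A),
    ⟨(MDHLC.isoOfOrderIso (B := RegularOpens.algebra (ContactEnd A.loc))
      (ContactEnd.orderIso A.loc) (ContactEnd.rel_orderIso A.loc)
      (ContactEnd.orderIso_mem_bounded A.loc)).symm⟩⟩

instance : regularOpens.{u}.IsEquivalence where

end HLC

theorem theorem3p10 : Nonempty (HLC.{u}ᵒᵖ ≌ MDHLC.{u}) :=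
  ⟨HLC.regularOpens.asEquivalence⟩
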